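/- Let $(\mathcal K,\otimes,\mathbb 1,\Sigma)$ be an (essentially small) tensor triangulated category, that is, a triangulated category with a symmetric monoidal structure and natural suspension isomorphisms $\Sigma a\otimes b\cong\Sigma(a\otimes b)\cong a\otimes\Sigma b$ that make $a\otimes-$ and $-\otimes b$ exact, are compatible with the symmetry, associator and unitors, and for which the two resulting isomorphisms $\Sigma a\otimes\Sigma b\to\Sigma^2(a\otimes b)$ differ by the sign $-1$. Let $\mathrm{Spc}(\mathcal K)$ be its Balmer spectrum: the set of prime (proper) thick $\otimes$-ideals $\mathcal P$ of $\mathcal K$, with closed sets $\{\mathcal P: S\cap\mathcal P=\emptyset\}$ for $S\subseteq\mathcal K$; write $\mathrm{supp}(a)=\{\mathcal P: a\notin\mathcal P\}$. For an object $X$ let $E_X$ be the ring of endomorphisms $f$ of $X$ such that $f\otimes X=X\otimes f$ on $X\otimes X$. For a non-empty set $\Phi$ of objects closed under $\otimes$, let $R_\Phi$ be the quotient of $\{(X,f):X\in\Phi,\ f\in E_X\}$ by the smallest equivalence relation with $(X,f)\sim(a\otimes X,a\otimes f)$ and $(X,f)\sim(X\otimes a,f\otimes a)$ for all $a\in\Phi$.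 It is a commutative ring with $[f_X]+[g_Y]=[f\otimes Y+X\otimes g]$ and $[f_X]\cdot[g_Y]=[(f\otimes Y)\circ(X\otimes g)]$. Put $\mathcal Z_\Phi=\bigcap_{X\in\Phi}\mathrm{supp}(X)\subseteq\mathrm{Spc}(\mathcal K)$ with the subspace topology. **Theorem.** For every such $\Phi$: 1. for $\mathcal P\in\mathcal Z_\Phi$ the condition $\mathrm{cone}(f)\notin\mathcal P$ depends only on the class $[f]\in R_\Phi$; 2. $\mathcal Z_\Phi$ is a spectral space, and for each $\mathcal P\in\mathcal Z_\Phi$ the set $\rho_\Phi(\mathcal P)=\{[f]\in R_\Phi:\mathrm{cone}(f)\notin\mathcal P\}$ is a prime ideal of $R_\Phi$; 3. the resulting map $\rho_\Phi:\mathcal Z_\Phi\to\mathrm{Spec}(R_\Phi)$ is inclusion-reversing ($\mathcal P\subseteq\mathcal Q$ implies $\rho_\Phi(\mathcal Q)\subseteq\rho_\Phi(\mathcal P)$) and spectral (continuous, with preimages of quasi-compact open sets quasi-compact). Special cases: for an object $X$ and $\Phi=\{X^{\otimes n}:n\ge1\}$ (all parenthesizations) one has $\mathcal Z_\Phi=\mathrm{supp}(X)$,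 which gives $\rho_X:\mathrm{supp}(X)\to\mathrm{Spec}(R_X)$ with $R_X=R_\Phi$; for a closed set $\mathcal Z\subseteq\mathrm{Spc}(\mathcal K)$ and $\Phi=\{a:\mathcal Z\subseteq\mathrm{supp}(a)\}$ one has $\mathcal Z_\Phi=\mathcal Z$, which gives $\rho_{\mathcal Z}:\mathcal Z\to\mathrm{Spec}(R_{\mathcal Z})$ with $R_{\mathcal Z}=R_\Phi$. -/

import Mathlib

open CategoryTheory CategoryTheory.Limits CategoryTheory.Pretriangulated
open scoped MonoidalCategory ZeroObject

universe v u

namespace TensorTriangular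

/-! ### Tensor triangulated categories -/

/-- A tensor triangulated category: a triangulated category with a symmetric monoidal structure,
suspension isomorphisms `Σa ⊗ b ≅ Σ(a ⊗ b)` and `a ⊗ Σb ≅ Σ(a ⊗ b)`, natural in both variables,
making `- ⊗ b` and `a ⊗ -` exact functors, compatible with the symmetry, the associator and the
unitors, and such that the two ways from `Σa ⊗ Σb` to `ΣΣ(a ⊗ b)` differ by a sign.
Here `Σ` is the shift by `1`. -/
class TensorTriangulated (C : Type u) [Category.{v} C] [HasZeroObject C] [HasShift C ℤ]
    [Preadditive C] [∀ n : ℤ, (shiftFunctor C n).Additive] [Pretriangulated C]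
    [IsTriangulated C] [MonoidalCategory C] [SymmetricCategory C]
    extends MonoidalPreadditive C where
  /-- `Σa ⊗ b ≅ Σ(a ⊗ b)` -/
  suspLeft (a b : C) : (a⟦(1 : ℤ)⟧) ⊗ b ≅ (a ⊗ b)⟦(1 : ℤ)⟧
  /-- `a ⊗ Σb ≅ Σ(a ⊗ b)` -/
  suspRight (a b : C) : a ⊗ (b⟦(1 : ℤ)⟧) ≅ (a ⊗ b)⟦(1 : ℤ)⟧
  suspLeft_natural {a a' b b' : C} (f : a ⟶ a') (g : b ⟶ b') :
    (f⟦(1 : ℤ)⟧' ⊗ₘ g) ≫ (suspLeft a' b').hom = (suspLeft a b).hom ≫ (f ⊗ₘ g)⟦(1 : ℤ)⟧'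
  suspRight_natural {a a' b b' : C} (f : a ⟶ a') (g : b ⟶ b') :
    (f ⊗ₘ g⟦(1 : ℤ)⟧') ≫ (suspRight a' b').hom = (suspRight a b).hom ≫ (f ⊗ₘ g)⟦(1 : ℤ)⟧'
  /-- `- ⊗ b` is exact. -/
  exact_right (T : Triangle C) (hT : T ∈ distTriang C) (b : C) :
    Triangle.mk (T.mor₁ ▷ b) (T.mor₂ ▷ b) (T.mor₃ ▷ b ≫ (suspLeft T.obj₁ b).hom) ∈ distTriang C
  /-- `a ⊗ -` is exact. -/
  exact_left (a : C) (T : Triangle C) (hT : T ∈ distTriang C) :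
    Triangle.mk (a ◁ T.mor₁) (a ◁ T.mor₂) (a ◁ T.mor₃ ≫ (suspRight a T.obj₁).hom) ∈ distTriang C
  susp_braiding (a b : C) :
    (suspLeft a b).hom ≫ (β_ a b).hom⟦(1 : ℤ)⟧' =
      (β_ (a⟦(1 : ℤ)⟧) b).hom ≫ (suspRight b a).hom
  susp_leftUnitor (b : C) :
    (suspRight (𝟙_ C) b).hom ≫ (λ_ b).hom⟦(1 : ℤ)⟧' = (λ_ (b⟦(1 : ℤ)⟧)).hom
  susp_rightUnitor (a : C) :
    (suspLeft a (𝟙_ C)).hom ≫ (ρ_ a).hom⟦(1 : ℤ)⟧' = (ρ_ (a⟦(1 : ℤ)⟧)).hom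
  susp_associator_left (a b c : C) :
    (suspLeft a b).hom ▷ c ≫ (suspLeft (a ⊗ b) c).hom ≫ (α_ a b c).hom⟦(1 : ℤ)⟧' =
      (α_ (a⟦(1 : ℤ)⟧) b c).hom ≫ (suspLeft a (b ⊗ c)).hom
  susp_associator_middle (a b c : C) :
    (suspRight a b).hom ▷ c ≫ (suspLeft (a ⊗ b) c).hom ≫ (α_ a b c).hom⟦(1 : ℤ)⟧' =
      (α_ a (b⟦(1 : ℤ)⟧) c).hom ≫ a ◁ (suspLeft b c).hom ≫ (suspRight a (b ⊗ c)).hom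
  susp_associator_right (a b c : C) :
    (suspRight (a ⊗ b) c).hom ≫ (α_ a b c).hom⟦(1 : ℤ)⟧' =
      (α_ a b (c⟦(1 : ℤ)⟧)).hom ≫ a ◁ (suspRight b c).hom ≫ (suspRight a (b ⊗ c)).hom
  susp_anticomm (a b : C) :
    (suspLeft a (b⟦(1 : ℤ)⟧)).hom ≫ (suspRight a b).hom⟦(1 : ℤ)⟧' =
      - ((suspRight (a⟦(1 : ℤ)⟧) b).hom ≫ (suspLeft a b).hom⟦(1 : ℤ)⟧')

/-! ### Balanced endomorphisms and the ring attached to a `⊗`-closed set of objects -/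

section Ring

variable {C : Type u} [Category.{v} C] [MonoidalCategory C]

/-- A non-empty set of objects closed under `⊗`. -/
structure TensorClosedSet (C : Type u) [Category.{v} C] [MonoidalCategory C] where
  carrier : Set C
  nonempty : carrier.Nonempty
  tensor_mem : ∀ {a b : C}, a ∈ carrier → b ∈ carrier → a ⊗ b ∈ carrier

theorem tensorHom_mem [SymmetricCategory C] {X Y : C} {f : X ⟶ X} {g : Y ⟶ Y}
    (hf : f ▷ X = X ◁ f) (hg : g ▷ Y = Y ◁ g) :
    (f ⊗ₘ g) ▷ (X ⊗ Y) = (X ⊗ Y) ◁ (f ⊗ₘ g) := by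
  have h1 := MonoidalCategory.tensorμ_natural_left f g X Y
  have h2 := MonoidalCategory.tensorμ_natural_right X Y f g
  rw [hf, hg, ← h2] at h1
  have := congrArg (· ≫ MonoidalCategory.tensorδ X Y X Y) h1
  simpa [Category.assoc, MonoidalCategory.tensorμ_tensorδ] using this

theorem whiskerLeft_mem [SymmetricCategory C] (a : C) {X : C} {f : X ⟶ X} (hf : f ▷ X = X ◁ f) :
    (a ◁ f) ▷ (a ⊗ X) = (a ⊗ X) ◁ (a ◁ f) := by
  simpa using tensorHom_mem (f := 𝟙 a) (g := f) (by simp) hf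

theorem whiskerRight_mem [SymmetricCategory C] (a : C) {X : C} {f : X ⟶ X} (hf : f ▷ X = X ◁ f) :
    (f ▷ a) ▷ (X ⊗ a) = (X ⊗ a) ◁ (f ▷ a) := by
  simpa using tensorHom_mem (f := f) (g := 𝟙 a) hf (by simp)

variable [Preadditive C] [MonoidalPreadditive C]

/-- The ring `E_X` of `⊗`-balanced endomorphisms of `X`: those `f` with `f ⊗ X = X ⊗ f`.
The product of the ring `End X` is composition, `f * g = f ∘ g`. -/
def balancedEnd (X : C) : Subring (End X) where
  carrier := {f : End X | (f : X ⟶ X) ▷ X = X ◁ (f : X ⟶ X)}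
  mul_mem' {f g} hf hg := by
    simp only [Set.mem_ofPred_eq, End.mul_def, MonoidalCategory.comp_whiskerRight,
      MonoidalCategory.whiskerLeft_comp] at *
    rw [hf, hg]
  one_mem' := by simp [End.one_def]
  add_mem' {f g} hf hg := by
    simp only [Set.mem_ofPred_eq] at *
    rw [MonoidalPreadditive.add_whiskerRight, MonoidalPreadditive.whiskerLeft_add, hf, hg]
  zero_mem' := by
    simp only [Set.mem_ofPred_eq]
    rw [MonoidalPreadditive.zero_whiskerRight, MonoidalPreadditive.whiskerLeft_zero]
  neg_mem' {f} hf := by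
    simp only [Set.mem_ofPred_eq] at *
    have h1 : (-f : X ⟶ X) ▷ X = -(f ▷ X) :=
      ((MonoidalCategory.tensorRight X).map_neg (f := f))
    have h2 : X ◁ (-f : X ⟶ X) = -(X ◁ f) :=
      ((MonoidalCategory.tensorLeft X).map_neg (f := f))
    rw [h1, h2, hf]

theorem mem_balancedEnd {X : C} {f : X ⟶ X} :
    (show End X from f) ∈ balancedEnd X ↔ f ▷ X = X ◁ f := Iff.rfl

variable [SymmetricCategory C]

/-- `a ⊗ -` as a map `E_X → E_{a ⊗ X}`. -/
def tensorLeftEnd (a : C) {X : C} (f : balancedEnd X) : balancedEnd (a ⊗ X) :=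
  ⟨(a ◁ (f.1 : X ⟶ X) : a ⊗ X ⟶ a ⊗ X), whiskerLeft_mem a f.2⟩

/-- `- ⊗ a` as a map `E_X → E_{X ⊗ a}`. -/
def tensorRightEnd {X : C} (f : balancedEnd X) (a : C) : balancedEnd (X ⊗ a) :=
  ⟨((f.1 : X ⟶ X) ▷ a : X ⊗ a ⟶ X ⊗ a), whiskerRight_mem a f.2⟩

/-- The set of pairs `(X, f)` with `X ∈ Φ` and `f ∈ E_X`. -/
abbrev Rep (Φ : TensorClosedSet C) := Σ X : Φ.carrier, balancedEnd X.1

/-- The generating relations `(X, f) ∼ (a ⊗ X, a ⊗ f)` and `(X, f) ∼ (X ⊗ a, f ⊗ a)`. -/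
inductive Step (Φ : TensorClosedSet C) : Rep Φ → Rep Φ → Prop
  | left (a X : Φ.carrier) (f : balancedEnd X.1) :
      Step Φ ⟨X, f⟩ ⟨⟨a.1 ⊗ X.1, Φ.tensor_mem a.2 X.2⟩, tensorLeftEnd a.1 f⟩
  | right (a X : Φ.carrier) (f : balancedEnd X.1) :
      Step Φ ⟨X, f⟩ ⟨⟨X.1 ⊗ a.1, Φ.tensor_mem X.2 a.2⟩, tensorRightEnd f a.1⟩

/-- `R_Φ`, the quotient of `{(X, f) : X ∈ Φ, f ∈ E_X}` by the smallest equivalence relation with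
`(X, f) ∼ (a ⊗ X, a ⊗ f)` and `(X, f) ∼ (X ⊗ a, f ⊗ a)` for all `a ∈ Φ`. -/
def R (Φ : TensorClosedSet C) := Quot (Step Φ)

namespace R

variable {Φ : TensorClosedSet C}

/-- The class `[f]` of `f ∈ E_X`, for `X ∈ Φ`. -/
def mk {X : C} (hX : X ∈ Φ.carrier) (f : balancedEnd X) : R Φ := Quot.mk _ ⟨⟨X, hX⟩, f⟩

theorem ind {p : R Φ → Prop} (h : ∀ {X : C} (hX : X ∈ Φ.carrier) (f : balancedEnd X), p (mk hX f))
    (r : R Φ) : p r :=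
  Quot.ind (fun x => h x.1.2 x.2) r

theorem mk_left {a X : C} (ha : a ∈ Φ.carrier) (hX : X ∈ Φ.carrier) (f : balancedEnd X) :
    mk (Φ.tensor_mem ha hX) (tensorLeftEnd a f) = mk hX f :=
  (Quot.sound (Step.left ⟨a, ha⟩ ⟨X, hX⟩ f)).symm

theorem mk_right {a X : C} (ha : a ∈ Φ.carrier) (hX : X ∈ Φ.carrier) (f : balancedEnd X) :
    mk (Φ.tensor_mem hX ha) (tensorRightEnd f a) = mk hX f :=
  (Quot.sound (Step.right ⟨a, ha⟩ ⟨X, hX⟩ f)).symm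

/-- Balanced endomorphisms that correspond under an isomorphism have the same class. -/
theorem mk_eq_of_iso {X Y : C} (hX : X ∈ Φ.carrier) (hY : Y ∈ Φ.carrier) (e : X ≅ Y)
    (f : balancedEnd X) (g : balancedEnd Y)
    (h : (f.1 : X ⟶ X) ≫ e.hom = e.hom ≫ (g.1 : Y ⟶ Y)) : mk hX f = mk hY g := by
  rw [← mk_right hY hX f, ← mk_left hX hY g]
  congr 1
  apply Subtype.ext
  change (f.1 : X ⟶ X) ▷ Y = X ◁ (g.1 : Y ⟶ Y)
  have hf : (f.1 : X ⟶ X) ▷ X = X ◁ (f.1 : X ⟶ X) := f.2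
  have hg : (g.1 : Y ⟶ Y) = e.inv ≫ (f.1 : X ⟶ X) ≫ e.hom := by rw [h]; simp
  rw [hg, MonoidalCategory.whiskerLeft_comp, MonoidalCategory.whiskerLeft_comp, ← hf,
    MonoidalCategory.whisker_exchange_assoc, ← MonoidalCategory.whiskerLeft_comp]
  simp

/-- `f ⊗ Y + X ⊗ g` as an element of `E_{X ⊗ Y}`. -/
def addRep {X Y : C} (f : balancedEnd X) (g : balancedEnd Y) : balancedEnd (X ⊗ Y) :=
  tensorRightEnd f Y + tensorLeftEnd X g

/-- `(f ⊗ Y) ∘ (X ⊗ g)` as an element of `E_{X ⊗ Y}`. -/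
def mulRep {X Y : C} (f : balancedEnd X) (g : balancedEnd Y) : balancedEnd (X ⊗ Y) :=
  tensorRightEnd f Y * tensorLeftEnd X g

theorem addRep_val {X Y : C} (f : balancedEnd X) (g : balancedEnd Y) :
    ((addRep f g).1 : X ⊗ Y ⟶ X ⊗ Y) = (f.1 : X ⟶ X) ▷ Y + X ◁ (g.1 : Y ⟶ Y) := rfl

theorem mulRep_val {X Y : C} (f : balancedEnd X) (g : balancedEnd Y) :
    ((mulRep f g).1 : X ⊗ Y ⟶ X ⊗ Y) = (f.1 : X ⟶ X) ⊗ₘ (g.1 : Y ⟶ Y) := by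
  rw [MonoidalCategory.tensorHom_def']; rfl

theorem addRep_comm {X Y : C} (hX : X ∈ Φ.carrier) (hY : Y ∈ Φ.carrier)
    (f : balancedEnd X) (g : balancedEnd Y) :
    mk (Φ.tensor_mem hX hY) (addRep f g) = mk (Φ.tensor_mem hY hX) (addRep g f) := by
  refine mk_eq_of_iso _ _ (β_ X Y) _ _ ?_
  rw [addRep_val, addRep_val]
  simp [Preadditive.add_comp, Preadditive.comp_add, add_comm]

theorem mulRep_comm {X Y : C} (hX : X ∈ Φ.carrier) (hY : Y ∈ Φ.carrier)
    (f : balancedEnd X) (g : balancedEnd Y) :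
    mk (Φ.tensor_mem hX hY) (mulRep f g) = mk (Φ.tensor_mem hY hX) (mulRep g f) := by
  refine mk_eq_of_iso _ _ (β_ X Y) _ _ ?_
  rw [mulRep_val, mulRep_val]
  simp

theorem addRep_step {x x' : Rep Φ} (h : Step Φ x x') {Y : C} (hY : Y ∈ Φ.carrier)
    (g : balancedEnd Y) :
    mk (Φ.tensor_mem x.1.2 hY) (addRep x.2 g) = mk (Φ.tensor_mem x'.1.2 hY) (addRep x'.2 g) := by
  have key (a X : Φ.carrier) (f : balancedEnd X.1) :
      mk (Φ.tensor_mem X.2 hY) (addRep f g) =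
        mk (Φ.tensor_mem (Φ.tensor_mem a.2 X.2) hY) (addRep (tensorLeftEnd a.1 f) g) := by
    rw [← mk_left a.2 (Φ.tensor_mem X.2 hY)]
    refine mk_eq_of_iso _ _ (α_ a.1 X.1 Y).symm _ _ ?_
    simp only [tensorLeftEnd, addRep_val]
    simp [Preadditive.add_comp, Preadditive.comp_add]
  cases h with
  | left a X f => exact key a X f
  | right a X f =>
    refine (key a X f).trans (Eq.symm ?_)
    refine mk_eq_of_iso _ _ (MonoidalCategory.whiskerRightIso (β_ X.1 a.1) Y) _ _ ?_
    simp only [tensorLeftEnd, tensorRightEnd, addRep_val]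
    simp only [Preadditive.add_comp, Preadditive.comp_add,
      MonoidalCategory.whiskerRightIso_hom, ← MonoidalCategory.comp_whiskerRight,
      ← MonoidalCategory.whisker_exchange, BraidedCategory.braiding_naturality_left]

theorem mulRep_step {x x' : Rep Φ} (h : Step Φ x x') {Y : C} (hY : Y ∈ Φ.carrier)
    (g : balancedEnd Y) :
    mk (Φ.tensor_mem x.1.2 hY) (mulRep x.2 g) = mk (Φ.tensor_mem x'.1.2 hY) (mulRep x'.2 g) := by
  have key (a X : Φ.carrier) (f : balancedEnd X.1) :
      mk (Φ.tensor_mem X.2 hY) (mulRep f g) =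
        mk (Φ.tensor_mem (Φ.tensor_mem a.2 X.2) hY) (mulRep (tensorLeftEnd a.1 f) g) := by
    rw [← mk_left a.2 (Φ.tensor_mem X.2 hY)]
    refine mk_eq_of_iso _ _ (α_ a.1 X.1 Y).symm _ _ ?_
    simp only [tensorLeftEnd, mulRep_val]
    simp [MonoidalCategory.tensorHom_def]
  cases h with
  | left a X f => exact key a X f
  | right a X f =>
    refine (key a X f).trans (Eq.symm ?_)
    refine mk_eq_of_iso _ _ (MonoidalCategory.whiskerRightIso (β_ X.1 a.1) Y) _ _ ?_
    simp only [tensorLeftEnd, tensorRightEnd, mulRep_val]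
    simp only [MonoidalCategory.whiskerRightIso_hom, MonoidalCategory.tensorHom_def, Category.assoc,
      MonoidalCategory.whisker_exchange]
    simp only [← MonoidalCategory.comp_whiskerRight_assoc, BraidedCategory.braiding_naturality_left]

/-- `[f_X] + [g_Y] = [f ⊗ Y + X ⊗ g]`. -/
instance : Add (R Φ) where
  add := Quot.lift₂
    (fun x y => mk (Φ.tensor_mem x.1.2 y.1.2) (addRep x.2 y.2))
    (fun x y y' h => by
      exact ((addRep_comm x.1.2 y.1.2 x.2 y.2).trans (addRep_step h x.1.2 x.2)).trans
        (addRep_comm y'.1.2 x.1.2 y'.2 x.2))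
    (fun _ _ y h => addRep_step h y.1.2 y.2)

/-- `[f_X] * [g_Y] = [(f ⊗ Y) ∘ (X ⊗ g)]`. -/
instance : Mul (R Φ) where
  mul := Quot.lift₂
    (fun x y => mk (Φ.tensor_mem x.1.2 y.1.2) (mulRep x.2 y.2))
    (fun x y y' h => by
      exact ((mulRep_comm x.1.2 y.1.2 x.2 y.2).trans (mulRep_step h x.1.2 x.2)).trans
        (mulRep_comm y'.1.2 x.1.2 y'.2 x.2))
    (fun _ _ y h => mulRep_step h y.1.2 y.2)

/-- `-[f] = [-f]`. -/
instance : Neg (R Φ) where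
  neg := Quot.lift (fun x => mk x.1.2 (-x.2)) (by
    rintro _ _ (⟨a, X, f⟩ | ⟨a, X, f⟩)
    · rw [← mk_left a.2 X.2]
      congr 1
      exact Subtype.ext ((MonoidalCategory.tensorLeft a.1).map_neg (f := (f.1 : X.1 ⟶ X.1)))
    · rw [← mk_right a.2 X.2]
      congr 1
      exact Subtype.ext ((MonoidalCategory.tensorRight a.1).map_neg (f := (f.1 : X.1 ⟶ X.1))))

noncomputable instance : Zero (R Φ) := ⟨mk Φ.nonempty.some_mem 0⟩

noncomputable instance : One (R Φ) := ⟨mk Φ.nonempty.some_mem 1⟩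

theorem mk_add_mk {X Y : C} (hX : X ∈ Φ.carrier) (hY : Y ∈ Φ.carrier)
    (f : balancedEnd X) (g : balancedEnd Y) :
    mk hX f + mk hY g = mk (Φ.tensor_mem hX hY) (addRep f g) := rfl

theorem mk_mul_mk {X Y : C} (hX : X ∈ Φ.carrier) (hY : Y ∈ Φ.carrier)
    (f : balancedEnd X) (g : balancedEnd Y) :
    mk hX f * mk hY g = mk (Φ.tensor_mem hX hY) (mulRep f g) := rfl

theorem neg_mk {X : C} (hX : X ∈ Φ.carrier) (f : balancedEnd X) : -mk hX f = mk hX (-f) := rfl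

/-- On each `E_X` with `X ∈ Φ` the operations of `R_Φ` restrict to those of `E_X`. -/
theorem mk_add {X : C} (hX : X ∈ Φ.carrier) (f g : balancedEnd X) :
    mk hX f + mk hX g = mk hX (f + g) := by
  rw [mk_add_mk, ← mk_right hX hX (f + g)]
  congr 1
  apply Subtype.ext
  have hg : (g.1 : X ⟶ X) ▷ X = X ◁ (g.1 : X ⟶ X) := g.2
  rw [addRep_val, ← hg]
  exact (MonoidalPreadditive.add_whiskerRight _ _).symm

theorem mk_mul {X : C} (hX : X ∈ Φ.carrier) (f g : balancedEnd X) :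
    mk hX f * mk hX g = mk hX (f * g) := by
  rw [mk_mul_mk, ← mk_right hX hX (f * g)]
  congr 1
  apply Subtype.ext
  have hg : (g.1 : X ⟶ X) ▷ X = X ◁ (g.1 : X ⟶ X) := g.2
  rw [mulRep_val, MonoidalCategory.tensorHom_def', ← hg]
  exact (MonoidalCategory.comp_whiskerRight _ _ _).symm

theorem mk_zero {X : C} (hX : X ∈ Φ.carrier) : mk hX 0 = (0 : R Φ) := by
  have hY := Φ.nonempty.some_mem
  change mk hX 0 = mk hY 0
  rw [← mk_right hY hX, ← mk_left hX hY]
  congr 1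
  apply Subtype.ext
  exact MonoidalPreadditive.zero_whiskerRight.trans MonoidalPreadditive.whiskerLeft_zero.symm

theorem mk_one {X : C} (hX : X ∈ Φ.carrier) : mk hX 1 = (1 : R Φ) := by
  have hY := Φ.nonempty.some_mem
  change mk hX 1 = mk hY 1
  rw [← mk_right hY hX, ← mk_left hX hY]
  congr 1
  apply Subtype.ext
  exact (MonoidalCategory.id_whiskerRight _ _).trans (MonoidalCategory.whiskerLeft_id _ _).symm

theorem exists_common (x y z : R Φ) : ∃ (X : C) (hX : X ∈ Φ.carrier) (f g h : balancedEnd X),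
    x = mk hX f ∧ y = mk hX g ∧ z = mk hX h := by
  induction x using ind with | h hX f
  induction y using ind with | h hY g
  induction z using ind with | h hZ h
  refine ⟨_, Φ.tensor_mem (Φ.tensor_mem hX hY) hZ, tensorRightEnd (tensorRightEnd f _) _,
    tensorRightEnd (tensorLeftEnd _ g) _, tensorLeftEnd _ h, ?_, ?_, ?_⟩
  · rw [mk_right hZ (Φ.tensor_mem hX hY), mk_right hY]
  · rw [mk_right hZ (Φ.tensor_mem hX hY), mk_left hX]
  · rw [mk_left (Φ.tensor_mem hX hY)]

noncomputable instance : CommRing (R Φ) where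
  add_assoc x y z := by
    obtain ⟨X, hX, f, g, h, rfl, rfl, rfl⟩ := exists_common x y z
    simp only [mk_add, add_assoc]
  zero_add x := by
    induction x using ind with | h hX f
    rw [← mk_zero hX, mk_add, zero_add]
  add_zero x := by
    induction x using ind with | h hX f
    rw [← mk_zero hX, mk_add, add_zero]
  add_comm x y := by
    induction x using ind with | h hX f
    induction y using ind with | h hY g
    exact addRep_comm hX hY f g
  nsmul := nsmulRec
  zsmul := zsmulRec
  neg_add_cancel x := by
    induction x using ind with | h hX f
    rw [neg_mk, mk_add, neg_add_cancel, mk_zero]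
  mul_assoc x y z := by
    obtain ⟨X, hX, f, g, h, rfl, rfl, rfl⟩ := exists_common x y z
    simp only [mk_mul, mul_assoc]
  one_mul x := by
    induction x using ind with | h hX f
    rw [← mk_one hX, mk_mul, one_mul]
  mul_one x := by
    induction x using ind with | h hX f
    rw [← mk_one hX, mk_mul, mul_one]
  zero_mul x := by
    induction x using ind with | h hX f
    rw [← mk_zero hX, mk_mul, zero_mul]
  mul_zero x := by
    induction x using ind with | h hX f
    rw [← mk_zero hX, mk_mul, mul_zero]
  left_distrib x y z := by
    obtain ⟨X, hX, f, g, h, rfl, rfl, rfl⟩ := exists_common x y z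
    simp only [mk_mul, mk_add, mul_add]
  right_distrib x y z := by
    obtain ⟨X, hX, f, g, h, rfl, rfl, rfl⟩ := exists_common x y z
    simp only [mk_mul, mk_add, add_mul]
  mul_comm x y := by
    induction x using ind with | h hX f
    induction y using ind with | h hY g
    exact mulRep_comm hX hY f g

end R

end Ring

/-! ### The Balmer spectrum -/

section Spectrum

variable {C : Type u} [Category.{v} C] [HasZeroObject C] [HasShift C ℤ]
  [Preadditive C] [∀ n : ℤ, (shiftFunctor C n).Additive] [Pretriangulated C]

/-- A cone of `f`: some object in a distinguished triangle `X ⟶ Y ⟶ cone f ⟶ ΣX` on `f`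
(unique up to isomorphism). -/
noncomputable def cone {X Y : C} (f : X ⟶ Y) : C :=
  (distinguished_cocone_triangle f).choose

variable [MonoidalCategory C]

variable (C) in
/-- A point of the spectrum: a prime thick `⊗`-ideal, that is, a full triangulated
subcategory closed under direct summands and under tensoring with arbitrary objects, which is
proper and contains `a` or `b` whenever it contains `a ⊗ b`. -/
structure Spc where
  carrier : ObjectProperty C
  isTriangulated : carrier.IsTriangulated
  isStableUnderRetracts : carrier.IsStableUnderRetracts
  tensor_left : ∀ (a : C) {b : C}, carrier b → carrier (a ⊗ b)
  tensor_right : ∀ {a : C} (b : C), carrier a → carrier (a ⊗ b)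
  proper : ∃ a : C, ¬ carrier a
  prime : ∀ {a b : C}, carrier (a ⊗ b) → carrier a ∨ carrier b

namespace Spc

/-- `a ∈ P` means that the object `a` lies in the prime `P`. -/
instance : Membership C (Spc C) := ⟨fun P a => P.carrier a⟩

/-- Inclusion of primes. -/
instance : LE (Spc C) := ⟨fun P Q => ∀ a : C, a ∈ P → a ∈ Q⟩

/-- The closed set `{P : S ∩ P = ∅}`. -/
def zeroLocus (S : Set C) : Set (Spc C) := {P | ∀ a ∈ S, a ∉ P}

/-- `supp(a) = {P : a ∉ P}`. -/
def supp (a : C) : Set (Spc C) := {P | a ∉ P}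

theorem zero_mem (P : Spc C) : (0 : C) ∈ P := by
  have := P.isTriangulated
  have := P.isStableUnderRetracts
  exact P.carrier.prop_zero

theorem biprod_mem_iff (P : Spc C) (a b : C) : (a ⊞ b) ∈ P ↔ a ∈ P ∧ b ∈ P := by
  have h1 := P.isTriangulated
  have h2 := P.isStableUnderRetracts
  refine ⟨fun h => ⟨?_, ?_⟩, fun h => ?_⟩
  · exact P.carrier.prop_of_retract ⟨biprod.inl, biprod.fst, by simp⟩ h
  · exact P.carrier.prop_of_retract ⟨biprod.inr, biprod.snd, by simp⟩ h
  · exact P.carrier.ext_of_isTriangulatedClosed₂ _ (binaryBiproductTriangle_distinguished a b)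
      h.1 h.2

/-- The Balmer topology: the closed sets are the `zeroLocus S` for `S` a set of objects. -/
instance : TopologicalSpace (Spc C) :=
  TopologicalSpace.ofClosed {Z | ∃ S : Set C, Z = zeroLocus S}
    ⟨Set.univ, by
      ext P
      simp only [Set.mem_empty_iff_false, zeroLocus, Set.mem_ofPred_eq, false_iff, not_forall]
      exact ⟨0, Set.mem_univ _, fun h => h P.zero_mem⟩⟩
    (fun A hA => ⟨{a | ∃ S : Set C, zeroLocus S ∈ A ∧ a ∈ S}, by
      ext P
      simp only [Set.mem_sInter]
      constructor
      · rintro h a ⟨S, hS, ha⟩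
        exact h _ hS a ha
      · intro h Z hZ
        obtain ⟨S, rfl⟩ := hA hZ
        exact fun a ha => h a ⟨S, hZ, ha⟩⟩)
    (by
      rintro _ ⟨S, rfl⟩ _ ⟨T, rfl⟩
      refine ⟨{c | ∃ a ∈ S, ∃ b ∈ T, c = (a ⊞ b : C)}, ?_⟩
      ext P
      constructor
      · rintro (h | h) c ⟨a, ha, b, hb, rfl⟩ hc
        · exact h a ha ((P.biprod_mem_iff a b).1 hc).1
        · exact h b hb ((P.biprod_mem_iff a b).1 hc).2
      · intro h
        by_contra hP
        simp only [Set.mem_union, not_or, zeroLocus, Set.mem_ofPred_eq, not_forall, not_not] at hP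
        obtain ⟨⟨a, ha, ha'⟩, b, hb, hb'⟩ := hP
        exact h _ ⟨a, ha, b, hb, rfl⟩ ((P.biprod_mem_iff a b).2 ⟨ha', hb'⟩))

theorem unit_notMem (P : Spc C) : 𝟙_ C ∉ P := by
  have h1 := P.isTriangulated
  have h2 := P.isStableUnderRetracts
  intro h
  obtain ⟨a, ha⟩ := P.proper
  exact ha (P.carrier.prop_of_iso (ρ_ a) (P.tensor_left a h))

/-- `Z_Φ`, the intersection of the supports of the objects in `Φ`. -/
def suppSet (Φ : TensorClosedSet C) : Set (Spc C) := ⋂ X ∈ Φ.carrier, supp X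

end Spc

end Spectrum

/-! ### The `⊗`-closed sets attached to an object and to a closed set -/

section Examples

variable {C : Type u} [Category.{v} C] [MonoidalCategory C]

/-- `IsTensorPower X Y`: the object `Y` is a tensor power `X ⊗ ⋯ ⊗ X` with at least one factor,
with some parenthesization. -/
inductive IsTensorPower (X : C) : C → Prop
  | base : IsTensorPower X X
  | tensor {a b : C} : IsTensorPower X a → IsTensorPower X b → IsTensorPower X (a ⊗ b)

/-- The set of all tensor powers `X^{⊗n}`, `n ≥ 1`. -/
def objectSet (X : C) : TensorClosedSet C where
  carrier := {Y | IsTensorPower X Y}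
  nonempty := ⟨X, .base⟩
  tensor_mem := .tensor

variable [HasZeroObject C] [HasShift C ℤ]
  [Preadditive C] [∀ n : ℤ, (shiftFunctor C n).Additive] [Pretriangulated C]

/-- The set of all objects whose support contains `Z`. -/
def closedSet (Z : Set (Spc C)) : TensorClosedSet C where
  carrier := {a | Z ⊆ Spc.supp a}
  nonempty := ⟨𝟙_ C, fun P _ => P.unit_notMem⟩
  tensor_mem ha hb P hP h := (P.prime h).elim (ha hP) (hb hP)

end Examples

end TensorTriangular

/-! The heart of the matter is to recognise "cone(f) avoids P" as a nilpotence condition. A balanced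
endomorphism f of X acts on X ⊗ cone(f) with square zero (`whiskerRight_cone_sq_eq_zero`). Hence,
for X ∉ P, cone(f) ∉ P if and only if f ⊗ W is nilpotent for some W ∉ P
(`cone_notMem_iff_isNilpotent`). Witnesses W can be tensored together because P is prime, and
commuting nilpotents are stable under sums and under multiplication by commuting elements, so the
classes in question form an ideal. Its complement is multiplicative because maps with cone in P
compose. Independence of the representative holds because cone(a ⊗ f) is a ⊗ cone(f), with a ∉ P.

On the topological side, every axiom of a prime can be tested on at most three objects, so a set of
objects that agrees with some prime on each triple is a prime (`Spc.exists_of_forall_triple`).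
Applied to ultrafilter limits this gives quasi-compactness of the basic opens {P : a ∈ P}; applied
to unions of primes it gives generic points. The closed subspace of primes avoiding Φ is then
spectral. The comparison map pulls the basic open of [f] back to that of cone(f)
(`comparison_preimage_basicOpen`), which makes it spectral. -/

namespace TensorTriangular

/-! ### Endomorphisms of tensor products -/

section Endomorphisms

variable {C : Type u} [Category.{v} C] [Preadditive C]

theorem isNilpotent_of_iso {A B : C} (e : A ≅ B) {f : End A} {g : End B}
    (h : (f : A ⟶ A) ≫ e.hom = e.hom ≫ (g : B ⟶ B)) (hf : IsNilpotent f) : IsNilpotent g := by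
  have hg : e.conj f = g := by simp [Iso.conj_apply, h]
  obtain ⟨n, hn⟩ := hf
  refine ⟨n, ?_⟩
  rw [← hg, ← map_pow, hn]
  simp [Iso.conj_apply]

variable [MonoidalCategory C] [MonoidalPreadditive C]

/-- `- ⊗ W` as a ring homomorphism `End X → End (X ⊗ W)`. -/
def whiskerRightEnd (X W : C) : End X →+* End (X ⊗ W) where
  toFun f := (f : X ⟶ X) ▷ W
  map_one' := MonoidalCategory.id_whiskerRight X W
  map_mul' f g := MonoidalCategory.comp_whiskerRight (g : X ⟶ X) (f : X ⟶ X) W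
  map_zero' := MonoidalPreadditive.zero_whiskerRight
  map_add' f g := MonoidalPreadditive.add_whiskerRight (f : X ⟶ X) (g : X ⟶ X)

/-- Nilpotence witnesses may be enlarged: up to the associator, f ⊗ (V ⊗ W) is the image of f ⊗ V
under the ring homomorphism - ⊗ W. -/
theorem isNilpotent_whiskerRightEnd_tensor {X : C} {f : End X} {V : C}
    (hf : IsNilpotent (whiskerRightEnd X V f)) (W : C) :
    IsNilpotent (whiskerRightEnd X (V ⊗ W) f) :=
  isNilpotent_of_iso (α_ X V W) (f := whiskerRightEnd (X ⊗ V) W (whiskerRightEnd X V f))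
    (by simp [whiskerRightEnd]) (hf.map (whiskerRightEnd (X ⊗ V) W))

theorem isNilpotent_whiskerRightEnd_of_iso {X : C} {f : End X} {V W : C} (e : V ≅ W)
    (hf : IsNilpotent (whiskerRightEnd X V f)) : IsNilpotent (whiskerRightEnd X W f) :=
  isNilpotent_of_iso (MonoidalCategory.whiskerLeftIso X e)
    (MonoidalCategory.whisker_exchange _ _).symm hf

/-- The interchange law. It supplies the commutation needed to add and multiply nilpotents on the
representatives of sums and products in `R Φ`. -/
theorem commute_tensorRightEnd_tensorLeftEnd [SymmetricCategory C] {X Y : C}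
    (f : balancedEnd X) (g : balancedEnd Y) :
    Commute (tensorRightEnd f Y).1 (tensorLeftEnd X g).1 :=
  MonoidalCategory.whisker_exchange _ _

end Endomorphisms

/-! ### Morphisms with cone in a prime -/

section Cone

variable {C : Type u} [Category.{v} C] [HasZeroObject C] [HasShift C ℤ]
  [Preadditive C] [∀ n : ℤ, (shiftFunctor C n).Additive] [Pretriangulated C]

theorem cone_distinguished {X Y : C} (f : X ⟶ Y) :
    ∃ (p : Y ⟶ cone f) (q : cone f ⟶ X⟦(1 : ℤ)⟧), Triangle.mk f p q ∈ distTriang C :=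
  (distinguished_cocone_triangle f).choose_spec

namespace Spc

section

variable [MonoidalCategory C] (P : Spc C)

instance : P.carrier.IsTriangulated := P.isTriangulated

instance : P.carrier.IsStableUnderRetracts := P.isStableUnderRetracts

theorem notMem_of_mem_suppSet {P : Spc C} {Φ : TensorClosedSet C} (hP : P ∈ suppSet Φ) {X : C}
    (hX : X ∈ Φ.carrier) : X ∉ P :=
  Set.mem_iInter₂.1 hP X hX

theorem tensor_mem_iff (a b : C) : a ⊗ b ∈ P ↔ a ∈ P ∨ b ∈ P :=
  ⟨P.prime, fun h => h.elim (P.tensor_right b) (P.tensor_left a)⟩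

/-- Passing to the class `trW` frees the condition from the chosen cone: any distinguished triangle
on f may be used to test it. -/
theorem cone_mem_iff_trW {X Y : C} (f : X ⟶ Y) : cone f ∈ P ↔ P.carrier.trW f := by
  obtain ⟨p, q, h⟩ := cone_distinguished f
  exact (P.carrier.trW_iff_of_distinguished _ h).symm

/-- The triangle on a zero map splits, so X is a retract of the cone. -/
theorem mem_of_cone_zero_mem {X : C} (h : cone (0 : X ⟶ X) ∈ P) : X ∈ P := by
  obtain ⟨p, q, hT⟩ := cone_distinguished (0 : X ⟶ X)
  obtain ⟨r, hr⟩ := Triangle.yoneda_exact₂ _ hT (𝟙 X) zero_comp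
  exact P.carrier.prop_of_retract ⟨p, r, hr.symm⟩ h

theorem cone_one_mem (X : C) : cone (𝟙 X) ∈ P :=
  (P.cone_mem_iff_trW _).2 (P.carrier.trW_of_isIso _)

theorem cone_comp_mem [IsTriangulated C] {X Y Z : C} {f : X ⟶ Y} {g : Y ⟶ Z} (hf : cone f ∈ P)
    (hg : cone g ∈ P) : cone (f ≫ g) ∈ P := by
  rw [cone_mem_iff_trW] at *
  exact P.carrier.trW.comp_mem _ _ hf hg

theorem cone_pow_mem [IsTriangulated C] {X : C} (f : End X) (hf : cone (f : X ⟶ X) ∈ P) (n : ℕ) :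
    cone ((f ^ n : End X) : X ⟶ X) ∈ P := by
  induction n with
  | zero => exact P.cone_one_mem X
  | succ n ih =>
    rw [pow_succ]
    exact P.cone_comp_mem hf ih

end

variable [IsTriangulated C] [MonoidalCategory C] [SymmetricCategory C] [TensorTriangulated C]
  (P : Spc C)

/-- By exactness of - ⊗ a, cone(f) ⊗ a completes f ⊗ a to a distinguished triangle; primeness does
the rest. -/
theorem cone_whiskerRight_mem_iff {X Y : C} (f : X ⟶ Y) (a : C) :
    cone (f ▷ a) ∈ P ↔ cone f ∈ P ∨ a ∈ P := by
  obtain ⟨p, q, h⟩ := cone_distinguished f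
  rw [cone_mem_iff_trW, ← P.tensor_mem_iff]
  exact P.carrier.trW_iff_of_distinguished _ (TensorTriangulated.exact_right _ h a)

theorem cone_whiskerLeft_mem_iff (a : C) {X Y : C} (f : X ⟶ Y) :
    cone (a ◁ f) ∈ P ↔ a ∈ P ∨ cone f ∈ P := by
  obtain ⟨p, q, h⟩ := cone_distinguished f
  rw [cone_mem_iff_trW, ← P.tensor_mem_iff]
  exact P.carrier.trW_iff_of_distinguished _ (TensorTriangulated.exact_left a _ h)

end Spc

variable [IsTriangulated C] [MonoidalCategory C] [SymmetricCategory C] [TensorTriangulated C]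

/-- A balanced endomorphism acts on its own cone with square zero. -/
theorem whiskerRight_cone_sq_eq_zero {X : C} {f : X ⟶ X} (hf : f ▷ X = X ◁ f) :
    f ▷ cone f ≫ f ▷ cone f = 0 := by
  obtain ⟨p, q, h⟩ := cone_distinguished f
  -- Balancedness moves f to the second factor of X ⊗ X, where it is killed by p. Hence f ⊗ cone(f)
  -- factors through X ⊗ q.
  have hp : (X ◁ p) ≫ f ▷ cone f = 0 := by
    have h₁₂ : f ≫ p = 0 := comp_distTriang_mor_zero₁₂ _ h
    rw [MonoidalCategory.whisker_exchange, hf, ← MonoidalCategory.whiskerLeft_comp, h₁₂,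
      MonoidalPreadditive.whiskerLeft_zero]
  -- Dually, f must change factors on X ⊗ ΣX. Balancedness is only given on X ⊗ X, so naturality of
  -- the suspension isomorphism transports it to the suspension.
  have hq : f ▷ cone f ≫ X ◁ q ≫ (TensorTriangulated.suspRight X X).hom = 0 := by
    have h₃₁ : q ≫ f⟦(1 : ℤ)⟧' = 0 := comp_distTriang_mor_zero₃₁ _ h
    have nat_left := TensorTriangulated.suspRight_natural f (𝟙 X)
    have nat_right := TensorTriangulated.suspRight_natural (𝟙 X) f
    simp only [CategoryTheory.Functor.map_id, MonoidalCategory.tensorHom_id,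
      MonoidalCategory.id_tensorHom] at nat_left nat_right
    rw [← MonoidalCategory.whisker_exchange_assoc, nat_left, hf, ← nat_right,
      ← MonoidalCategory.whiskerLeft_comp_assoc, h₃₁, MonoidalPreadditive.whiskerLeft_zero,
      zero_comp]
  obtain ⟨r, hr⟩ : ∃ r : (X ⊗ X)⟦(1 : ℤ)⟧ ⟶ X ⊗ cone f,
      f ▷ cone f = (X ◁ q ≫ (TensorTriangulated.suspRight X X).hom) ≫ r :=
    Triangle.yoneda_exact₃ _ (TensorTriangulated.exact_left X _ h) _ hp
  -- Factoring only the second copy through X ⊗ q leaves the composite that `hq` kills.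
  nth_rw 2 [hr]
  rw [← Category.assoc, hq, zero_comp]

/-- For `X ∉ P`, the cone of a balanced endomorphism `f` of `X` avoids the prime `P` if and only
if `f ⊗ W` is nilpotent for some `W ∉ P`. -/
theorem cone_notMem_iff_isNilpotent (P : Spc C) {X : C} (hX : X ∉ P) (f : balancedEnd X) :
    cone (f.1 : X ⟶ X) ∉ P ↔ ∃ W : C, W ∉ P ∧ IsNilpotent (whiskerRightEnd X W f.1) := by
  -- The witness is W = cone(f) itself, with exponent 2.
  refine ⟨fun h => ⟨_, h, 2, ?_⟩, ?_⟩
  · rw [pow_two]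
    exact whiskerRight_cone_sq_eq_zero f.2
  · rintro ⟨W, hW, n, hn⟩ hf
    -- If cone(f) ∈ P, all powers of f ⊗ W have cone in P. One of them is zero, which forces X ⊗ W ∈
    -- P, against primeness.
    have h := P.cone_pow_mem (whiskerRightEnd X W f.1)
      ((P.cone_whiskerRight_mem_iff _ W).2 (Or.inl hf)) n
    rw [hn] at h
    exact ((P.tensor_mem_iff X W).1 (P.mem_of_cone_zero_mem h)).elim hX hW

theorem cone_add_notMem_of_commute (P : Spc C) {X : C} (hX : X ∉ P) {f g : balancedEnd X}
    (hfg : Commute f.1 g.1) (hf : cone (f.1 : X ⟶ X) ∉ P) (hg : cone (g.1 : X ⟶ X) ∉ P) :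
    cone ((f + g).1 : X ⟶ X) ∉ P := by
  rw [cone_notMem_iff_isNilpotent P hX] at hf hg ⊢
  obtain ⟨V, hV, hfV⟩ := hf
  obtain ⟨W, hW, hgW⟩ := hg
  -- Both summands become nilpotent over the common witness V ⊗ W, which primeness keeps outside P.
  refine ⟨V ⊗ W, fun h => (P.prime h).elim hV hW, ?_⟩
  have h₁ := isNilpotent_whiskerRightEnd_tensor hfV W
  have h₂ := isNilpotent_whiskerRightEnd_of_iso (β_ W V) (isNilpotent_whiskerRightEnd_tensor hgW V)
  rw [show (f + g).1 = f.1 + g.1 from rfl, map_add]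
  exact (hfg.map (whiskerRightEnd X (V ⊗ W))).isNilpotent_add h₁ h₂

theorem cone_mul_notMem_of_commute (P : Spc C) {X : C} (hX : X ∉ P) {f g : balancedEnd X}
    (hfg : Commute f.1 g.1) (hg : cone (g.1 : X ⟶ X) ∉ P) : cone ((f * g).1 : X ⟶ X) ∉ P := by
  rw [cone_notMem_iff_isNilpotent P hX] at hg ⊢
  obtain ⟨W, hW, hgW⟩ := hg
  refine ⟨W, hW, ?_⟩
  rw [show (f * g).1 = f.1 * g.1 from rfl, map_mul]
  exact (hfg.map (whiskerRightEnd X W)).isNilpotent_mul_left hgW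

end Cone

/-! ### The comparison map -/

section Comparison

variable {C : Type u} [Category.{v} C] [HasZeroObject C] [HasShift C ℤ]
  [Preadditive C] [∀ n : ℤ, (shiftFunctor C n).Additive] [Pretriangulated C]
  [IsTriangulated C] [MonoidalCategory C] [SymmetricCategory C] [TensorTriangulated C]
  {Φ : TensorClosedSet C}

/-- The condition `cone f ∉ P` on the class `[f]`. -/
def R.ConeNotMem (P : Spc.suppSet Φ) : R Φ → Prop :=
  Quot.lift (fun x => cone (x.2.1 : x.1.1 ⟶ x.1.1) ∉ P.1) (by
    rintro _ _ (⟨a, X, f⟩ | ⟨a, X, f⟩)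
    · have ha := Spc.notMem_of_mem_suppSet P.2 a.2
      exact propext (not_congr (((P.1.cone_whiskerLeft_mem_iff a.1 _).trans
        (or_iff_right ha)).symm))
    · have ha := Spc.notMem_of_mem_suppSet P.2 a.2
      exact propext (not_congr (((P.1.cone_whiskerRight_mem_iff _ a.1).trans
        (or_iff_left ha)).symm)))

/-- The prime ideal `{[f] : cone f ∉ P}` of `R_Φ`. -/
def comparison (P : Spc.suppSet Φ) : PrimeSpectrum (R Φ) where
  asIdeal :=
    { carrier := {r | R.ConeNotMem P r}
      add_mem' := fun {r s} hr hs => by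
        induction r using R.ind with | h hX f
        induction s using R.ind with | h hY g
        have hX' := Spc.notMem_of_mem_suppSet P.2 hX
        have hY' := Spc.notMem_of_mem_suppSet P.2 hY
        have hXY := Spc.notMem_of_mem_suppSet P.2 (Φ.tensor_mem hX hY)
        -- The sum is represented on X ⊗ Y, where the two summands have cones cone(f) ⊗ Y and X ⊗
        -- cone(g), both outside P.
        refine cone_add_notMem_of_commute P.1 hXY
          (commute_tensorRightEnd_tensorLeftEnd f g) ?_ ?_
        · exact fun h => ((P.1.cone_whiskerRight_mem_iff _ _).1 h).elim hr hY'
        · exact fun h => ((P.1.cone_whiskerLeft_mem_iff _ _).1 h).elim hX' hs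
      zero_mem' := fun h => Spc.notMem_of_mem_suppSet P.2 Φ.nonempty.some_mem
        (P.1.mem_of_cone_zero_mem h)
      smul_mem' := fun r s hs => by
        induction r using R.ind with | h hX f
        induction s using R.ind with | h hY g
        have hX' := Spc.notMem_of_mem_suppSet P.2 hX
        have hXY := Spc.notMem_of_mem_suppSet P.2 (Φ.tensor_mem hX hY)
        refine cone_mul_notMem_of_commute P.1 hXY (commute_tensorRightEnd_tensorLeftEnd f g) ?_
        exact fun h => ((P.1.cone_whiskerLeft_mem_iff _ _).1 h).elim hX' hs }
  isPrime :=
    { ne_top' := (Ideal.ne_top_iff_one _).2 fun h => h (P.1.cone_one_mem _)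
      mem_or_mem' := fun {r s} h => by
        induction r using R.ind with | h hX f
        induction s using R.ind with | h hY g
        by_contra! hn
        have hf : cone (f.1 : _ ⟶ _) ∈ P.1 := not_not.1 hn.1
        have hg : cone (g.1 : _ ⟶ _) ∈ P.1 := not_not.1 hn.2
        -- The product is the composite of X ⊗ g followed by f ⊗ Y; if both have cone in P, so does
        -- the composite.
        exact h (P.1.cone_comp_mem ((P.1.cone_whiskerLeft_mem_iff _ _).2 (Or.inr hg))
          ((P.1.cone_whiskerRight_mem_iff _ _).2 (Or.inl hf))) }

theorem mem_comparison_iff (P : Spc.suppSet Φ) {X : C} (hX : X ∈ Φ.carrier) (f : balancedEnd X) :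
    R.mk hX f ∈ (comparison P).asIdeal ↔ cone (f.1 : X ⟶ X) ∉ P.1 := Iff.rfl

end Comparison

/-! ### The topology of the spectrum -/

namespace Spc

variable {C : Type u} [Category.{v} C] [HasZeroObject C] [HasShift C ℤ]
  [Preadditive C] [∀ n : ℤ, (shiftFunctor C n).Additive] [Pretriangulated C] [MonoidalCategory C]

theorem ext_of_mem_iff {P Q : Spc C} (h : ∀ a, a ∈ P ↔ a ∈ Q) : P = Q := by
  have : P.carrier = Q.carrier := funext fun a => propext (h a)
  cases P
  cases Q
  congr

/-- A set of objects that agrees on every three objects with some prime is itself a prime. -/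
theorem exists_of_forall_triple (p : C → Prop)
    (h : ∀ a b c : C, ∃ Q : Spc C, (a ∈ Q ↔ p a) ∧ (b ∈ Q ↔ p b) ∧ (c ∈ Q ↔ p c)) :
    ∃ P : Spc C, ∀ a, a ∈ P ↔ p a := by
  let S : ObjectProperty C := p
  have hr : S.IsStableUnderRetracts := ⟨fun {X Y} r hY => by
    obtain ⟨Q, hX, hY', -⟩ := h X Y Y
    exact hX.1 (Q.carrier.prop_of_retract r (hY'.2 hY))⟩
  have ht : S.IsTriangulated :=
    { exists_zero := by
        obtain ⟨Q, h0, -⟩ := h 0 0 0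
        exact ⟨0, isZero_zero C, h0.1 Q.zero_mem⟩
      isStableUnderShiftBy := fun n => ⟨fun X hX => by
        obtain ⟨Q, h1, h2, -⟩ := h X (X⟦n⟧) X
        exact h2.1 (Q.carrier.le_shift n _ (h1.2 hX))⟩
      ext₂' := fun T hT hT₁ hT₃ => by
        obtain ⟨Q, h1, h2, h3⟩ := h T.obj₁ T.obj₂ T.obj₃
        exact S.le_isoClosure _ (h2.1
          (Q.carrier.ext_of_isTriangulatedClosed₂ T hT (h1.2 hT₁) (h3.2 hT₃))) }
  -- Properness is existential, but the unit lies in no prime, so it serves as a fixed witness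
  -- testable on a single object.
  refine ⟨⟨S, ht, hr, fun a b hb => ?_, fun {a} b ha => ?_, ⟨𝟙_ C, fun hu => ?_⟩,
    fun {a b} hab => ?_⟩, fun a => Iff.rfl⟩
  · obtain ⟨Q, h1, h2, -⟩ := h b (a ⊗ b) b
    exact h2.1 (Q.tensor_left a (h1.2 hb))
  · obtain ⟨Q, h1, h2, -⟩ := h a (a ⊗ b) a
    exact h2.1 (Q.tensor_right b (h1.2 ha))
  · obtain ⟨Q, h1, -⟩ := h (𝟙_ C) (𝟙_ C) (𝟙_ C)
    exact Q.unit_notMem (h1.2 hu)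
  · obtain ⟨Q, h1, h2, h3⟩ := h (a ⊗ b) a b
    exact (Q.prime (h1.2 hab)).imp h2.1 h3.1

theorem isClosed_iff {Z : Set (Spc C)} : IsClosed Z ↔ ∃ S : Set C, Z = zeroLocus S := by
  rw [← isOpen_compl_iff]
  change (∃ S : Set C, Zᶜᶜ = zeroLocus S) ↔ _
  rw [compl_compl]

theorem isClosed_zeroLocus (S : Set C) : IsClosed (zeroLocus S) := isClosed_iff.2 ⟨S, rfl⟩

/-- The basic open set `{P : a ∈ P}`. -/
def basicOpen (a : C) : Set (Spc C) := {P | a ∈ P}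

theorem isOpen_basicOpen (a : C) : IsOpen (basicOpen a) := by
  rw [← isClosed_compl_iff]
  convert! isClosed_zeroLocus {a} using 1
  ext P
  simp [basicOpen, zeroLocus]

theorem basicOpen_inter (a b : C) : basicOpen a ∩ basicOpen b = basicOpen (a ⊞ b) :=
  Set.ext fun P => (P.biprod_mem_iff a b).symm

theorem isTopologicalBasis_basicOpen :
    TopologicalSpace.IsTopologicalBasis (Set.range (basicOpen (C := C))) := by
  refine TopologicalSpace.isTopologicalBasis_of_isOpen_of_nhds ?_ ?_
  · rintro _ ⟨a, rfl⟩
    exact isOpen_basicOpen a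
  · intro P U hP hU
    obtain ⟨S, hS⟩ := isClosed_iff.1 hU.isClosed_compl
    have hP' : P ∉ zeroLocus S := hS ▸ fun h => h hP
    simp only [zeroLocus, Set.mem_ofPred_eq, not_forall, not_not] at hP'
    obtain ⟨a, ha, haP⟩ := hP'
    refine ⟨_, ⟨a, rfl⟩, haP, fun Q hQ => ?_⟩
    by_contra hQU
    have hQS : Q ∈ zeroLocus S := hS ▸ hQU
    exact hQS a ha hQ

/-- The prime to which an ultrafilter of primes converges in the constructible topology. -/
theorem exists_mem_iff_eventually (F : Ultrafilter (Spc C)) :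
    ∃ P : Spc C, ∀ a, a ∈ P ↔ ∀ᶠ Q in (F : Filter (Spc C)), a ∈ Q := by
  refine exists_of_forall_triple _ fun a b c => ?_
  -- An ultrafilter decides membership of each object, so almost every Q agrees with the limit at a.
  -- Three such conditions hold simultaneously for some Q.
  have key (a : C) : ∀ᶠ Q in (F : Filter (Spc C)), a ∈ Q ↔ ∀ᶠ Q in (F : Filter (Spc C)), a ∈ Q := by
    by_cases h : ∀ᶠ Q in (F : Filter (Spc C)), a ∈ Q
    · filter_upwards [h] with Q hQ using iff_of_true hQ h
    · filter_upwards [Ultrafilter.eventually_not.2 h] with Q hQ using iff_of_false hQ h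
  exact ((key a).and ((key b).and (key c))).exists

theorem isCompact_basicOpen (a : C) : IsCompact (basicOpen a) := by
  rw [isCompact_iff_ultrafilter_le_nhds']
  intro F hF
  obtain ⟨P, hP⟩ := exists_mem_iff_eventually F
  refine ⟨P, (hP a).2 hF, ?_⟩
  rw [isTopologicalBasis_basicOpen.nhds_hasBasis.ge_iff]
  rintro _ ⟨⟨b, rfl⟩, hb⟩
  exact (hP b).1 hb

instance : CompactSpace (Spc C) :=
  ⟨by
    convert! isCompact_basicOpen (0 : C) using 1
    exact (Set.eq_univ_of_forall fun P => P.zero_mem).symm⟩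

instance : PrespectralSpace (Spc C) :=
  .of_isTopologicalBasis' isTopologicalBasis_basicOpen isCompact_basicOpen

instance : T0Space (Spc C) where
  t0 P Q h := by
    refine ext_of_mem_iff fun a => ?_
    exact (h.mem_open_iff (isOpen_basicOpen a))

/-- The generic point of an irreducible closed set is the union of its primes. Irreducibility makes
any three nonempty traces of basic opens meet, so this union agrees on each triple with one of the
primes. -/
instance : QuasiSober (Spc C) where
  sober {Z} hZ hZc := by
    obtain ⟨S, rfl⟩ := isClosed_iff.1 hZc
    have hu (a b : C) (ha : (zeroLocus S ∩ basicOpen a).Nonempty)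
        (hb : (zeroLocus S ∩ basicOpen b).Nonempty) :
        (zeroLocus S ∩ basicOpen (a ⊞ b)).Nonempty := by
      rw [← basicOpen_inter]
      exact hZ.2 _ _ (isOpen_basicOpen a) (isOpen_basicOpen b) ha hb
    -- The basic open of a' meets the closed set, and on the intersection membership of a is already
    -- decided: a' = a if a lies in some prime of the set, and a' = 0 otherwise.
    have key (a : C) : ∃ a' : C, (zeroLocus S ∩ basicOpen a').Nonempty ∧
        ∀ Q ∈ zeroLocus S, a' ∈ Q → (a ∈ Q ↔ (zeroLocus S ∩ basicOpen a).Nonempty) := by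
      by_cases h : (zeroLocus S ∩ basicOpen a).Nonempty
      · exact ⟨a, h, fun Q _ hQ => iff_of_true hQ h⟩
      · obtain ⟨P, hP⟩ := hZ.nonempty
        exact ⟨0, ⟨P, hP, P.zero_mem⟩, fun Q hQ _ => iff_of_false (fun ha => h ⟨Q, hQ, ha⟩) h⟩
    obtain ⟨P, hP⟩ := exists_of_forall_triple
      (fun a => (zeroLocus S ∩ basicOpen a).Nonempty) fun a b c => by
        obtain ⟨a', ha, ha'⟩ := key a
        obtain ⟨b', hb, hb'⟩ := key b
        obtain ⟨c', hc, hc'⟩ := key c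
        obtain ⟨Q, hQ, h⟩ := hu _ _ ha (hu _ _ hb hc)
        have h₁ := (Q.biprod_mem_iff _ _).1 h
        have h₂ := (Q.biprod_mem_iff _ _).1 h₁.2
        exact ⟨Q, ha' Q hQ h₁.1, hb' Q hQ h₂.1, hc' Q hQ h₂.2⟩
    -- The closure of a point consists of the primes contained in it, so the union of the primes in
    -- the closed set is generic once it belongs to that set.
    refine ⟨P, (hZc.closure_subset_iff.2 (Set.singleton_subset_iff.2 ?_)).antisymm ?_⟩
    · intro a ha haP
      obtain ⟨Q, hQ, haQ⟩ := (hP a).1 haP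
      exact hQ a ha haQ
    · intro Q hQ
      rw [isTopologicalBasis_basicOpen.mem_closure_iff]
      rintro _ ⟨a, rfl⟩ haQ
      exact ⟨P, (hP a).2 ⟨Q, hQ, haQ⟩, rfl⟩

variable {Z : Set (Spc C)}

theorem isTopologicalBasis_preimage_basicOpen (Z : Set (Spc C)) :
    TopologicalSpace.IsTopologicalBasis
      (Set.range fun a : C => ((↑) ⁻¹' basicOpen a : Set Z)) := by
  convert! isTopologicalBasis_basicOpen.isInducing
    (Topology.IsInducing.subtypeVal (t := Z)) using 1
  exact Set.range_comp (Set.preimage Subtype.val) basicOpen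

theorem isCompact_preimage_basicOpen (hZ : IsClosed Z) (a : C) :
    IsCompact ((↑) ⁻¹' basicOpen a : Set Z) :=
  hZ.isClosedEmbedding_subtypeVal.isCompact_preimage (isCompact_basicOpen a)

theorem spectralSpace_of_isClosed (hZ : IsClosed Z) : SpectralSpace Z :=
  have : QuasiSober Z := hZ.isClosedEmbedding_subtypeVal.quasiSober
  have : CompactSpace Z := hZ.isClosedEmbedding_subtypeVal.compactSpace
  have : PrespectralSpace Z := .of_isTopologicalBasis' (isTopologicalBasis_preimage_basicOpen Z)
    (isCompact_preimage_basicOpen hZ)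
  have : QuasiSeparatedSpace Z := .of_isTopologicalBasis (isTopologicalBasis_preimage_basicOpen Z)
    fun a b => by
      rw [← Set.preimage_inter, basicOpen_inter]
      exact isCompact_preimage_basicOpen hZ _
  {}

theorem suppSet_eq_zeroLocus (Φ : TensorClosedSet C) : suppSet Φ = zeroLocus Φ.carrier := by
  ext P
  simp [suppSet, zeroLocus, supp]

theorem isClosed_suppSet (Φ : TensorClosedSet C) : IsClosed (suppSet Φ) :=
  suppSet_eq_zeroLocus Φ ▸ isClosed_zeroLocus _

theorem suppSet_objectSet (X : C) : suppSet (objectSet X) = supp X := by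
  refine Set.Subset.antisymm (Set.iInter₂_subset X IsTensorPower.base) fun P hP => ?_
  rw [suppSet_eq_zeroLocus]
  intro Y hY
  induction hY with
  | base => exact hP
  | tensor _ _ ha hb => exact fun h => (P.prime h).elim ha hb

theorem suppSet_closedSet (hZ : IsClosed Z) : suppSet (closedSet Z) = Z := by
  rw [suppSet_eq_zeroLocus]
  refine Set.Subset.antisymm ?_ fun P hP a ha => ha hP
  obtain ⟨S, rfl⟩ := isClosed_iff.1 hZ
  -- Every a in a defining set S of Z has support containing Z, hence already belongs to `closedSet
  -- Z`.
  exact fun P hP a ha => hP a fun Q hQ => hQ a ha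

end Spc

section Comparison

variable {C : Type u} [Category.{v} C] [HasZeroObject C] [HasShift C ℤ]
  [Preadditive C] [∀ n : ℤ, (shiftFunctor C n).Additive] [Pretriangulated C]
  [IsTriangulated C] [MonoidalCategory C] [SymmetricCategory C] [TensorTriangulated C]
  {Φ : TensorClosedSet C}

/-- Every element of `R Φ` is a single class [f], so this covers all of the standard basis. Openness
of the right-hand side gives continuity, its quasi-compactness gives spectrality. -/
theorem comparison_preimage_basicOpen {X : C} (hX : X ∈ Φ.carrier) (f : balancedEnd X) :
    comparison ⁻¹' (PrimeSpectrum.basicOpen (R.mk hX f) : Set (PrimeSpectrum (R Φ))) =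
      ((↑) ⁻¹' Spc.basicOpen (cone (f.1 : X ⟶ X)) : Set (Spc.suppSet Φ)) := by
  ext P
  exact (not_congr (mem_comparison_iff P hX f)).trans not_not

theorem isSpectralMap_comparison : IsSpectralMap (comparison (Φ := Φ)) where
  toContinuous := by
    refine PrimeSpectrum.isTopologicalBasis_basic_opens.continuous_iff.2 ?_
    rintro _ ⟨r, rfl⟩
    induction r using R.ind with | h hX f
    rw [comparison_preimage_basicOpen]
    exact (Spc.isOpen_basicOpen _).preimage continuous_subtype_val
  isCompact_preimage_of_isOpen U hU hUc := by
    -- A quasi-compact open is a finite union of standard basic opens, which reduces the claim to a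
    -- single [f].
    obtain ⟨s, hs, rfl⟩ := (isCompact_open_iff_eq_finite_iUnion_of_isTopologicalBasis _
      PrimeSpectrum.isTopologicalBasis_basic_opens PrimeSpectrum.isCompact_basicOpen U).1 ⟨hUc, hU⟩
    rw [Set.preimage_iUnion₂]
    refine hs.isCompact_biUnion fun r _ => ?_
    induction r using R.ind with | h hX f
    rw [comparison_preimage_basicOpen]
    exact Spc.isCompact_preimage_basicOpen (Spc.isClosed_suppSet Φ) _

end Comparison

end TensorTriangular

open CategoryTheory CategoryTheory.Limits TensorTriangular in
theorem mainTheorem1 {C : Type u} [Category.{v} C] [HasZeroObject C] [HasShift C ℤ]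
    [Preadditive C] [∀ n : ℤ, (shiftFunctor C n).Additive] [Pretriangulated C]
    [IsTriangulated C] [MonoidalCategory C] [SymmetricCategory C] [TensorTriangulated C] :
    (∀ Φ : TensorClosedSet C,
      -- the condition `cone f ∉ P` depends only on the class `[f]`
      (∀ P ∈ Spc.suppSet Φ, ∀ (X Y : C) (hX : X ∈ Φ.carrier) (hY : Y ∈ Φ.carrier)
        (f : balancedEnd X) (g : balancedEnd Y), R.mk hX f = R.mk hY g →
          (cone (f.1 : X ⟶ X) ∉ P ↔ cone (g.1 : Y ⟶ Y) ∉ P)) ∧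
      SpectralSpace (Spc.suppSet Φ) ∧
      ∃ ρ : Spc.suppSet Φ → PrimeSpectrum (R Φ),
        (∀ P : Spc.suppSet Φ, ((ρ P).asIdeal : Set (R Φ)) =
          {r | ∃ (X : C) (hX : X ∈ Φ.carrier) (f : balancedEnd X),
            r = R.mk hX f ∧ cone (f.1 : X ⟶ X) ∉ P.1}) ∧
        (∀ P Q : Spc.suppSet Φ, P.1 ≤ Q.1 → (ρ Q).asIdeal ≤ (ρ P).asIdeal) ∧
        IsSpectralMap ρ) ∧
    (∀ X : C, Spc.suppSet (objectSet X) = Spc.supp X) ∧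
    (∀ Z : Set (Spc C), IsClosed Z → Spc.suppSet (closedSet Z) = Z) := by
  refine ⟨fun Φ => ⟨fun P hP X Y hX hY f g h => ?_,
    Spc.spectralSpace_of_isClosed (Spc.isClosed_suppSet Φ), comparison, fun P => ?_,
    fun P Q hPQ r hr => ?_, isSpectralMap_comparison⟩, Spc.suppSet_objectSet,
    fun Z hZ => Spc.suppSet_closedSet hZ⟩
  · rw [← mem_comparison_iff ⟨P, hP⟩ hX f, h]
    rfl
  · ext r
    refine ⟨fun hr => ?_, ?_⟩
    · induction r using R.ind with | h hX f
      exact ⟨_, hX, f, rfl, hr⟩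
    · rintro ⟨X, hX, f, rfl, hf⟩
      exact hf
  · induction r using R.ind with | h hX f
    exact fun h => hr (hPQ _ h)
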